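/- Let $k,d\ge 1$ and $n\ge 0$ be integers. A $k$-local Hamiltonian of degree at most $d$ on $n$ qubits is an operator $H=\sum_j h_j$ that is a finite sum of Hermitian operators, each acting on at most $k$ qubits (as the identity on the others), such that each qubit is acted on by at most $d$ of the $h_j$. Write $H=\sum_{P\in\{I,X,Y,Z\}^{\otimes n}}\alpha_P P$ for its Pauli expansion, $\|H\|_{\mathrm{Pauli},1}=\sum_P|\alpha_P|$, and let $\|H\|$ be the spectral norm. Put \[ C(k,d)=\frac{\sqrt{2\,(k!)}}{\sqrt d\;k^{k+2.5}\,(2\sqrt6+4\sqrt3)^k}. \] Then: 1. For all $n\ge0$, $k,d\ge1$, every $n$-qubit $k$-local Hamiltonian $H$ of degree at most $d$ satisfies $\tfrac13\,C(k,d)\,\|H\|_{\mathrm{Pauli},1}\le\|H\|$. 2. $C(k,d)=1/(\sqrt d\,\exp(\Theta(k\log k)))$; that is, there is a function $g$ of $k$ alone with $g(k)=\Theta(k\log k)$ as $k\to\infty$ and $C(k,d)=1/(\sqrt d\,e^{g(k)})$ for all $k,d\ge1$. 3. Consequently $\|H\|_{\mathrm{Pauli},1}=O(\|H\|)$ for constant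 $k$ and $d$: for all $k,d\ge1$ there is $K>0$, depending only on $k$ and $d$, such that $\|H\|_{\mathrm{Pauli},1}\le K\|H\|$ for every $n$ and every $n$-qubit $k$-local Hamiltonian $H$ of degree at most $d$. -/

import Mathlib

open Filter Asymptotics
open scoped Matrix.Norms.L2Operator

/-- Operators on `n` qubits, as matrices in the computational basis `{0,1}^n`. With
`Matrix.Norms.L2Operator` open, `‖H‖` is the spectral norm. -/
abbrev QubitOp (n : ℕ) : Type := Matrix (Fin n → Fin 2) (Fin n → Fin 2) ℂ

/-- The single-qubit Pauli matrices `I, X, Y, Z`. -/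
noncomputable def pauliMatrix : Fin 4 → Matrix (Fin 2) (Fin 2) ℂ :=
  ![1, !![0, 1; 1, 0], !![0, -Complex.I; Complex.I, 0], !![1, 0; 0, -1]]

/-- The `n`-qubit Pauli operator `P₁ ⊗ ⋯ ⊗ Pₙ`. -/
noncomputable def pauliString {n : ℕ} (P : Fin n → Fin 4) : QubitOp n :=
  Matrix.of fun x y => ∏ i, pauliMatrix (P i) (x i) (y i)

/-- The coefficient `α_P = Tr(P H) / 2ⁿ` of `P` in the Pauli expansion of `H`
(see `sum_pauliCoeff` and `pauliCoeff_unique`). -/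
noncomputable def pauliCoeff {n : ℕ} (H : QubitOp n) (P : Fin n → Fin 4) : ℂ :=
  (pauliString P * H).trace / 2 ^ n

theorem sum_pauliMatrix (a b x y : Fin 2) :
    ∑ p, pauliMatrix p a b * pauliMatrix p x y = if a = y ∧ b = x then 2 else 0 := by
  fin_cases a <;> fin_cases b <;> fin_cases x <;> fin_cases y <;>
    simp [Fin.sum_univ_four, pauliMatrix] <;> norm_num

theorem trace_pauliMatrix (p q : Fin 4) :
    ∑ a, ∑ b, pauliMatrix p a b * pauliMatrix q b a = if p = q then 2 else 0 := by
  fin_cases p <;> fin_cases q <;>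
    simp [Fin.sum_univ_two, pauliMatrix] <;> norm_num

/-- Every operator is the Pauli sum `∑_P α_P P`. -/
theorem sum_pauliCoeff {n : ℕ} (H : QubitOp n) :
    ∑ P, pauliCoeff H P • pauliString P = H := by
  have key : ∀ a b x y : Fin n → Fin 2,
      ∑ P : Fin n → Fin 4, pauliString P a b * pauliString P x y
        = if a = y ∧ b = x then 2 ^ n else 0 := by
    intro a b x y
    simp only [pauliString, Matrix.of_apply, ← Finset.prod_mul_distrib]
    rw [← Fintype.prod_sum fun i p => pauliMatrix p (a i) (b i) * pauliMatrix p (x i) (y i)]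
    simp only [sum_pauliMatrix]
    split_ifs with h
    · simp [h.1, h.2]
    · rw [not_and_or, funext_iff, funext_iff, not_forall, not_forall] at h
      obtain ⟨i, hi⟩ | ⟨i, hi⟩ := h <;>
        exact Finset.prod_eq_zero (Finset.mem_univ i) (by simp [hi])
  ext x y
  simp only [Matrix.sum_apply, Matrix.smul_apply, smul_eq_mul, pauliCoeff, Matrix.trace,
    Matrix.diag_apply, Matrix.mul_apply, Finset.sum_div, Finset.sum_mul]
  rw [Finset.sum_comm]
  have : ∀ a, ∑ P : Fin n → Fin 4, ∑ b, pauliString P a b * H b a / 2 ^ n * pauliString P x y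
      = ∑ b, H b a / 2 ^ n * (if a = y ∧ b = x then 2 ^ n else 0) := by
    intro a
    rw [Finset.sum_comm]
    refine Finset.sum_congr rfl fun b _ => ?_
    rw [← key a b x y, Finset.mul_sum]
    exact Finset.sum_congr rfl fun P _ => by ring
  simp only [this]
  rw [Finset.sum_eq_single y, Finset.sum_eq_single x]
  · simp
  · intro b _ hb; simp [hb]
  · simp
  · intro a _ ha; simp [ha]
  · simp

/-- The Pauli expansion is unique. -/
theorem pauliCoeff_unique {n : ℕ} (β : (Fin n → Fin 4) → ℂ) (P : Fin n → Fin 4) :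
    pauliCoeff (∑ Q, β Q • pauliString Q) P = β P := by
  have key : ∀ Q : Fin n → Fin 4, (pauliString P * pauliString Q).trace
      = if P = Q then 2 ^ n else 0 := by
    intro Q
    have h1 : (pauliString P * pauliString Q).trace = ∑ a : Fin n → Fin 2,
        ∏ i, ∑ b, pauliMatrix (P i) (a i) b * pauliMatrix (Q i) b (a i) := by
      simp only [Matrix.trace, Matrix.diag_apply, Matrix.mul_apply, pauliString, Matrix.of_apply,
        ← Finset.prod_mul_distrib]
      exact Finset.sum_congr rfl fun a _ => (Fintype.prod_sum fun i b =>
        pauliMatrix (P i) (a i) b * pauliMatrix (Q i) b (a i)).symm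
    rw [h1, ← Fintype.prod_sum fun i a => ∑ b, pauliMatrix (P i) a b * pauliMatrix (Q i) b a]
    simp only [trace_pauliMatrix]
    split_ifs with h
    · simp [h]
    · rw [funext_iff, not_forall] at h
      obtain ⟨i, hi⟩ := h
      exact Finset.prod_eq_zero (Finset.mem_univ i) (by simp [hi])
  simp [pauliCoeff, Matrix.mul_sum, Matrix.trace_sum, key]

/-- The Pauli-`p` norm `(∑_P |α_P|^p)^(1/p)`. -/
noncomputable def pauliNorm {n : ℕ} (p : ℝ) (H : QubitOp n) : ℝ :=
  (∑ P : Fin n → Fin 4, ‖pauliCoeff H P‖ ^ p) ^ (1 / p)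

/-- `M` acts only on the qubits in `S`: it is `A ⊗ I` for an operator `A` on the qubits in `S`
and the identity on the qubits outside `S`. -/
def ActsOnlyOn {n : ℕ} (S : Finset (Fin n)) (M : QubitOp n) : Prop :=
  ∃ A : Matrix (S → Fin 2) (S → Fin 2) ℂ, ∀ x y : Fin n → Fin 2,
    M x y = if ∀ i, i ∉ S → x i = y i then A (fun i => x i) (fun i => y i) else 0

/-- `H` is a `k`-local Hamiltonian of degree at most `d`: a finite sum of observables, each acting
on at most `k` qubits, such that every qubit is acted on by at most `d` of them. -/
def IsLocalHamiltonian {n : ℕ} (k d : ℕ) (H : QubitOp n) : Prop :=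
  ∃ (m : ℕ) (h : Fin m → QubitOp n) (S : Fin m → Finset (Fin n)),
    H = ∑ j, h j ∧
    (∀ j, (h j).IsHermitian) ∧
    (∀ j, ActsOnlyOn (S j) (h j)) ∧
    (∀ j, (S j).card ≤ k) ∧
    ∀ i, (Finset.univ.filter fun j => i ∈ S j).card ≤ d

/-- `C(k,d) = √(2 k!) / (√d k^(k+5/2) (2√6 + 4√3)^k)`. -/
noncomputable def normConst (k d : ℕ) : ℝ :=
  √(2 * (k.factorial : ℝ)) /
    (√(d : ℝ) * (k : ℝ) ^ ((k : ℝ) + 5 / 2) * (2 * √6 + 4 * √3) ^ k)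

/-! A product state has energy at most `‖H‖` in absolute value, and this energy is a multilinear
polynomial in the Bloch coordinates whose coefficients are the Pauli coefficients. Restricting every
Bloch coordinate to `[-1/√3, 1/√3]` keeps each Bloch vector in the unit ball. Hence, after
rescaling, a polynomial on the cube `[-1,1]^(3n)` is bounded by `‖H‖`, has degree at most `k`, and
has each variable in at most `d * 4^(k-1)` monomials. It remains to bound the `ℓ¹` norm of the
coefficients of such a polynomial `p` (`sum_abs_coeff_le`). For a vertex `χ`, move from `χ/2` in the
sign direction of the gradient: this gives a univariate polynomial bounded on `[-1,1]`, whose linear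
coefficient controls the `ℓ¹` norm of the gradient (`abs_coeff_one_le`, `sum_abs_gradient_le`).
Average over `χ`. By hypercontractivity the mean of each `|∂_v p|` is at least a constant times its
`L²` norm (`sqrt_sum_sq_le_sum_abs`), and by Cauchy–Schwarz this is at least the `ℓ¹` norm of the
coefficients at `v` divided by the square root of their number. This last step is the source of
`√d`. The resulting constant is exponential in `k`, so the stated one, which decays like `exp(-Θ(k
log k))`, follows by a numerical comparison. -/

/-! ### Linear coefficient of a bounded univariate polynomial -/

open Polynomial in
/-- The linear coefficient of a polynomial of degree at most `k` that is bounded by `M` on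
`[-1, 1]`. -/
theorem abs_coeff_one_le (k : ℕ) : ∀ (q : ℝ[X]) (M : ℝ), q.natDegree ≤ k + 1 →
    (∀ t : ℝ, |t| ≤ 1 → |q.eval t| ≤ M) → |q.coeff 1| ≤ 5 ^ k * M := by
  induction k with
  | zero =>
    intro q M hq hM
    have e : q = C (q.coeff 1) * X + C (q.coeff 0) := eq_X_add_C_of_natDegree_le_one (by simpa using hq)
    have e1 : q.eval 1 = q.coeff 1 + q.coeff 0 := by conv_lhs => rw [e]; simp
    have e2 : q.eval (-1) = -q.coeff 1 + q.coeff 0 := by conv_lhs => rw [e]; simp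
    have h1 := hM 1 (by simp)
    have h2 := hM (-1) (by simp)
    rw [e1, abs_le] at h1
    rw [e2, abs_le] at h2
    rw [abs_le]
    constructor <;> linarith [h1.1, h1.2, h2.1, h2.2]
  | succ k ih =>
    intro q M hq hM
    have hM0 : 0 ≤ M := (abs_nonneg _).trans (hM 0 (by simp))
    -- This combination kills the coefficient of degree `k + 2` and multiplies the linear one by
    -- `2^(k+1) - 1`. The loss is `(2^(k+2) + 1) / (2^(k+1) - 1) ≤ 5`, with equality at `k = 0`.
    set p : ℝ[X] := C (2 ^ (k + 2)) * q.comp (C (1 / 2) * X) - q with hp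
    have hc : ∀ j, p.coeff j = (2 ^ (k + 2) * (1 / 2) ^ j - 1) * q.coeff j := by
      intro j
      simp only [hp, coeff_sub, coeff_C_mul, comp_C_mul_X_coeff]
      ring
    have hdeg : p.natDegree ≤ k + 1 := by
      rw [natDegree_le_iff_coeff_eq_zero]
      intro j hj
      rw [hc]
      rcases Nat.lt_or_ge (k + 2) j with h | h
      · rw [coeff_eq_zero_of_natDegree_lt (lt_of_le_of_lt hq h), mul_zero]
      · obtain rfl : j = k + 2 := by omega
        rw [← mul_pow]; norm_num
    have hb : ∀ t : ℝ, |t| ≤ 1 → |p.eval t| ≤ (2 ^ (k + 2) + 1) * M := by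
      intro t ht
      have h1 := hM t ht
      have h2 := hM (1 / 2 * t) (by rw [abs_mul]; norm_num; linarith)
      have e : p.eval t = 2 ^ (k + 2) * q.eval (1 / 2 * t) - q.eval t := by simp [hp]
      rw [e]
      refine (abs_sub _ _).trans ?_
      rw [abs_mul, abs_of_pos (by positivity : (0 : ℝ) < 2 ^ (k + 2))]
      have := mul_le_mul_of_nonneg_left h2 (by positivity : (0 : ℝ) ≤ 2 ^ (k + 2))
      linarith
    have h := ih p _ hdeg hb
    rw [hc] at h
    have hpow : (1 : ℝ) ≤ 2 ^ k := one_le_pow₀ (by norm_num)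
    have e : (2 : ℝ) ^ (k + 2) * (1 / 2) ^ 1 - 1 = 2 * 2 ^ k - 1 := by rw [pow_add]; ring
    rw [e, abs_mul, abs_of_pos (by linarith)] at h
    have h5 : (2 : ℝ) ^ (k + 2) + 1 ≤ 5 * (2 * 2 ^ k - 1) := by rw [pow_add]; linarith
    have h6 : (2 * 2 ^ k - 1) * |q.coeff 1| ≤ (2 * 2 ^ k - 1) * (5 ^ (k + 1) * M) := by
      refine h.trans ?_
      have := mul_le_mul_of_nonneg_right h5 (by positivity : (0 : ℝ) ≤ 5 ^ k * M)
      rw [pow_succ 5 k]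
      linarith
    exact le_of_mul_le_mul_left h6 (by linarith)

/-! ### Walsh expansions and hypercontractivity -/

/-- The sign `-1` for the elements of `T`, and `1` outside `T`. -/
def signAt {V : Type*} [DecidableEq V] (T : Finset V) (v : V) : ℝ := if v ∈ T then -1 else 1

/-- The multilinear polynomial `∑_S c_S ∏_{v ∈ S} y_v` in the variables `W`. -/
def multilin {V : Type*} (W : Finset V) (c : Finset V → ℝ) (y : V → ℝ) : ℝ :=
  ∑ S ∈ W.powerset, c S * ∏ v ∈ S, y v

theorem multilin_congr {V : Type*} {W : Finset V} {c : Finset V → ℝ} {y z : V → ℝ}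
    (h : ∀ v ∈ W, y v = z v) : multilin W c y = multilin W c z := by
  refine Finset.sum_congr rfl fun S hS => ?_
  rw [Finset.prod_congr rfl fun v hv => h v (Finset.mem_powerset.1 hS hv)]

section Walsh
variable {V : Type*} [DecidableEq V]

theorem multilin_insert {W : Finset V} {v : V} (hv : v ∉ W) (c : Finset V → ℝ) (y : V → ℝ) :
    multilin (insert v W) c y
      = multilin W c y + y v * multilin W (fun S => c (insert v S)) y := by
  unfold multilin
  rw [Finset.sum_powerset_insert hv, Finset.mul_sum]
  congr 1
  refine Finset.sum_congr rfl fun S hS => ?_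
  rw [Finset.prod_insert fun h => hv (Finset.mem_powerset.1 hS h)]
  ring

/-- Summing over the signs of one more variable. -/
theorem sum_multilin_insert {W : Finset V} {v : V} (hv : v ∉ W) (c : Finset V → ℝ)
    (φ : ℝ → ℝ) :
    ∑ T ∈ (insert v W).powerset, φ (multilin (insert v W) c (signAt T))
      = ∑ T ∈ W.powerset,
        (φ (multilin W c (signAt T) + multilin W (fun S => c (insert v S)) (signAt T))
          + φ (multilin W c (signAt T) - multilin W (fun S => c (insert v S)) (signAt T))) := by
  rw [Finset.sum_powerset_insert hv, Finset.sum_add_distrib]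
  congr 1 <;> refine Finset.sum_congr rfl fun T hT => ?_
  · have hvT : v ∉ T := fun h => hv (Finset.mem_powerset.1 hT h)
    rw [multilin_insert hv]
    simp [signAt, hvT]
  · have h : ∀ u ∈ W, signAt (insert v T) u = signAt T u := by
      intro u hu
      have : u ≠ v := by rintro rfl; exact hv hu
      simp [signAt, this]
    rw [multilin_insert hv, multilin_congr h, multilin_congr h]
    simp [signAt, sub_eq_add_neg]

/-- Parseval: adding one variable replaces a value `a` by `a + b` and `a - b`, and the parallelogram
law applies. -/
theorem sum_multilin_sq (W : Finset V) : ∀ c : Finset V → ℝ,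
    ∑ T ∈ W.powerset, multilin W c (signAt T) ^ 2 = 2 ^ W.card * ∑ S ∈ W.powerset, c S ^ 2 := by
  induction W using Finset.induction_on with
  | empty => intro c; simp [multilin]
  | insert v W hv ih =>
    intro c
    rw [sum_multilin_insert hv c (fun x => x ^ 2), Finset.sum_powerset_insert hv,
      Finset.card_insert_of_notMem hv]
    have e : ∀ a b : ℝ, (a + b) ^ 2 + (a - b) ^ 2 = 2 * a ^ 2 + 2 * b ^ 2 := fun a b => by ring
    simp only [e, Finset.sum_add_distrib, ← Finset.mul_sum, ih]
    ring

/-- The (2,4)-hypercontractive inequality on the discrete cube. -/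
theorem sum_multilin_pow_four_le (W : Finset V) : ∀ c : Finset V → ℝ,
    ∑ T ∈ W.powerset, multilin W c (signAt T) ^ 4
      ≤ 2 ^ W.card * (∑ S ∈ W.powerset, 3 ^ S.card * c S ^ 2) ^ 2 := by
  induction W using Finset.induction_on with
  | empty => intro c; simp [multilin, ← pow_mul]
  | insert v W hv ih =>
    intro c
    rw [sum_multilin_insert hv c (fun x => x ^ 4), Finset.sum_powerset_insert hv,
      Finset.card_insert_of_notMem hv]
    -- Odd powers cancel. With Cauchy–Schwarz for the mixed term, the bound is `2G² + 12GH + 2H² ≤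
    -- 2(G + 3H)²`; the weight 3 matches the mixed term exactly.
    have e : ∀ a b : ℝ, (a + b) ^ 4 + (a - b) ^ 4 = 2 * a ^ 4 + 12 * (a ^ 2 * b ^ 2) + 2 * b ^ 4 :=
      fun a b => by ring
    have e3 : ∑ S ∈ W.powerset, (3 : ℝ) ^ (insert v S).card * c (insert v S) ^ 2
        = 3 * ∑ S ∈ W.powerset, (3 : ℝ) ^ S.card * c (insert v S) ^ 2 := by
      rw [Finset.mul_sum]
      refine Finset.sum_congr rfl fun S hS => ?_
      rw [Finset.card_insert_of_notMem fun h => hv (Finset.mem_powerset.1 hS h), pow_succ]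
      ring
    simp only [e, Finset.sum_add_distrib, ← Finset.mul_sum, e3]
    have hg := ih c
    have hh := ih fun S => c (insert v S)
    set G := ∑ S ∈ W.powerset, (3 : ℝ) ^ S.card * c S ^ 2
    set H := ∑ S ∈ W.powerset, (3 : ℝ) ^ S.card * c (insert v S) ^ 2
    have hG : 0 ≤ G := Finset.sum_nonneg fun S _ => by positivity
    have hH : 0 ≤ H := Finset.sum_nonneg fun S _ => by positivity
    have hcs := Finset.sum_mul_sq_le_sq_mul_sq W.powerset
      (fun T => multilin W c (signAt T) ^ 2)
      (fun T => multilin W (fun S => c (insert v S)) (signAt T) ^ 2)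
    simp only [← pow_mul, Nat.reduceMul] at hcs
    have hx : ∑ T ∈ W.powerset, multilin W c (signAt T) ^ 2 *
        multilin W (fun S => c (insert v S)) (signAt T) ^ 2 ≤ 2 ^ W.card * (G * H) := by
      refine abs_le_of_sq_le_sq' (hcs.trans ?_) (by positivity) |>.2
      refine (mul_le_mul hg hh (Finset.sum_nonneg fun T _ => by positivity)
        (by positivity)).trans (le_of_eq (by ring))
    rw [pow_succ]
    have hN : (0 : ℝ) < 2 ^ W.card := by positivity
    nlinarith [mul_nonneg hN.le (mul_nonneg hH hH)]

/-- The `L¹` norm of a multilinear polynomial of degree `k` is at least `3⁻ᵏ` times its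
`L²` norm. -/
theorem sqrt_sum_sq_le_sum_abs (W : Finset V) (k : ℕ) (c : Finset V → ℝ)
    (hc : ∀ S, k < S.card → c S = 0) :
    2 ^ W.card * √(∑ S ∈ W.powerset, c S ^ 2)
      ≤ 3 ^ k * ∑ T ∈ W.powerset, |multilin W c (signAt T)| := by
  set σ := √(∑ S ∈ W.powerset, c S ^ 2) with hσ
  have h0 : 0 ≤ ∑ S ∈ W.powerset, c S ^ 2 := Finset.sum_nonneg fun S _ => sq_nonneg _
  have hσ2 : σ ^ 2 = ∑ S ∈ W.powerset, c S ^ 2 := Real.sq_sqrt h0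
  have hσ0 : 0 ≤ σ := Real.sqrt_nonneg _
  clear_value σ
  rcases hσ0.eq_or_lt with rfl | hpos
  · rw [mul_zero]
    exact mul_nonneg (by positivity) (Finset.sum_nonneg fun _ _ => abs_nonneg _)
  have h2 := sum_multilin_sq W c
  have h4 := sum_multilin_pow_four_le W c
  have h3 : ∑ S ∈ W.powerset, 3 ^ S.card * c S ^ 2 ≤ 3 ^ k * σ ^ 2 := by
    rw [hσ2, Finset.mul_sum]
    refine Finset.sum_le_sum fun S _ => ?_
    rcases Nat.lt_or_ge k S.card with h | h
    · simp [hc S h]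
    · gcongr; norm_num
  rw [← hσ2] at h2
  set s := 3 ^ k * σ with hs
  have hs0 : 0 < s := by positivity
  -- A pointwise substitute for Hölder, from `|x| (|x| - s)² (|x| + 2s) ≥ 0`. The choice `s = 3^k σ`
  -- makes the fourth moment at most `s² σ²`.
  have hpt : ∀ x : ℝ, 3 * s ^ 2 * x ^ 2 - x ^ 4 ≤ 2 * s ^ 3 * |x| := by
    intro x
    have : 0 ≤ |x| * ((|x| - s) ^ 2 * (|x| + 2 * s)) := by positivity
    have e2 : |x| ^ 2 = x ^ 2 := sq_abs x
    have e4 : |x| ^ 4 = x ^ 4 := by rw [show 4 = 2 * 2 from rfl, pow_mul, sq_abs, ← pow_mul]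
    nlinarith
  have hsum := Finset.sum_le_sum fun T (_ : T ∈ W.powerset) => hpt (multilin W c (signAt T))
  rw [Finset.sum_sub_distrib, ← Finset.mul_sum, ← Finset.mul_sum, h2] at hsum
  have h4' : ∑ T ∈ W.powerset, multilin W c (signAt T) ^ 4 ≤ 2 ^ W.card * (s ^ 2 * σ ^ 2) := by
    refine h4.trans ?_
    have : (∑ S ∈ W.powerset, 3 ^ S.card * c S ^ 2) ^ 2 ≤ (3 ^ k * σ ^ 2) ^ 2 :=
      pow_le_pow_left₀ (Finset.sum_nonneg fun S _ => by positivity) h3 2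
    have := mul_le_mul_of_nonneg_left this (by positivity : (0 : ℝ) ≤ 2 ^ W.card)
    refine this.trans (le_of_eq ?_)
    rw [hs]; ring
  set A := ∑ T ∈ W.powerset, |multilin W c (signAt T)|
  have key : s ^ 2 * (2 ^ W.card * σ * σ) ≤ s ^ 2 * (s * A) := by nlinarith
  have key2 := le_of_mul_le_mul_left key (by positivity)
  refine le_of_mul_le_mul_left (a := σ) ?_ hpos
  calc σ * (2 ^ W.card * σ) = 2 ^ W.card * σ * σ := by ring
    _ ≤ s * A := key2
    _ = σ * (3 ^ k * A) := by rw [hs]; ring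

end Walsh

/-! ### From a bound on the cube to a bound on the coefficients -/

open Polynomial in
theorem coeff_one_prod_affine {V : Type*} [DecidableEq V] (S : Finset V) (a b : V → ℝ) :
    (∏ v ∈ S, (C (a v) + C (b v) * X)).coeff 1 = ∑ v ∈ S, b v * ∏ u ∈ S.erase v, a u := by
  have h := coeff_derivative (∏ v ∈ S, (C (a v) + C (b v) * X)) 0
  rw [derivative_prod_finset, coeff_zero_eq_eval_zero] at h
  simp only [Nat.cast_zero, zero_add, mul_one] at h
  rw [← h, eval_finsetSum]
  refine Finset.sum_congr rfl fun v _ => ?_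
  rw [eval_mul, eval_prod, mul_comm]
  simp

section Cube
variable {V : Type*} [Fintype V] [DecidableEq V]

open Polynomial in
/-- If a multilinear polynomial of degree at most `k + 1` is bounded by `M` on the cube, so is,
up to a constant, the `ℓ¹` norm of its gradient at half a vertex. -/
theorem sum_abs_gradient_le (k : ℕ) (c : Finset V → ℝ) (hdeg : ∀ S, k + 1 < S.card → c S = 0)
    (M : ℝ) (hM : ∀ y : V → ℝ, (∀ v, |y v| ≤ 1) → |∑ S, c S * ∏ v ∈ S, y v| ≤ M)
    (T : Finset V) :
    ∑ v, |multilin Finset.univ (fun S => if v ∈ S then c S / 2 ^ S.card else 0) (signAt T)|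
      ≤ 5 ^ k * M := by
  have hχ : ∀ v, |signAt T v| = 1 := by intro v; unfold signAt; split_ifs <;> simp
  have hχ2 : ∀ v, signAt T v * signAt T v = 1 := by
    intro v; rw [← sq, ← sq_abs, hχ, one_pow]
  -- `g v` is half the partial derivative at `χ/2`, where `χ = signAt T`; the multilinear form in
  -- the statement is `χ_v * g v`, of the same absolute value.
  set g : V → ℝ := fun v =>
    ∑ S : Finset V, if v ∈ S then c S / 2 ^ S.card * ∏ u ∈ S.erase v, signAt T u else 0 with hg
  have h1 : ∀ v, |multilin Finset.univ (fun S => if v ∈ S then c S / 2 ^ S.card else 0)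
      (signAt T)| = |g v| := by
    intro v
    have : multilin Finset.univ (fun S => if v ∈ S then c S / 2 ^ S.card else 0) (signAt T)
        = signAt T v * g v := by
      simp only [multilin, hg, Finset.mul_sum, Finset.powerset_univ]
      refine Finset.sum_congr rfl fun S _ => ?_
      split_ifs with h
      · rw [← Finset.mul_prod_erase _ _ h]; ring
      · simp
    rw [this, abs_mul, hχ, one_mul]
  simp only [h1]
  set t : V → ℝ := fun v => if 0 ≤ g v then 1 else -1 with ht
  have ht1 : ∀ v, |t v| = 1 := by intro v; simp only [ht]; split_ifs <;> simp
  have htg : ∀ v, t v * g v = |g v| := by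
    intro v
    simp only [ht]
    split_ifs with h
    · rw [one_mul, abs_of_nonneg h]
    · rw [neg_one_mul, abs_of_neg (not_le.1 h)]
  -- `q(s)` is the value of the polynomial at `(χ + s t)/2`, a point of the cube when `|s| ≤ 1`; the
  -- base point is halved for this reason.
  set q : ℝ[X] := ∑ S : Finset V,
    C (c S / 2 ^ S.card) * ∏ v ∈ S, (C (signAt T v) + C (t v) * X) with hq
  have hdegq : q.natDegree ≤ k + 1 := by
    refine natDegree_sum_le_of_forall_le _ _ fun S _ => ?_
    rcases Nat.lt_or_ge (k + 1) S.card with h | h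
    · simp [hdeg S h]
    · refine (natDegree_C_mul_le _ _).trans ((natDegree_prod_le _ _).trans ?_)
      refine (Finset.sum_le_card_nsmul _ _ 1 fun v _ => ?_).trans (by simpa using h)
      compute_degree
  have heval : ∀ s : ℝ, |s| ≤ 1 → |q.eval s| ≤ M := by
    intro s hs
    have e : q.eval s = ∑ S : Finset V, c S * ∏ v ∈ S, ((signAt T v + t v * s) / 2) := by
      rw [hq, eval_finsetSum]
      refine Finset.sum_congr rfl fun S _ => ?_
      simp only [eval_mul, eval_C, eval_prod, eval_add, eval_X, Finset.prod_div_distrib,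
        Finset.prod_const]
      ring
    rw [e]
    refine hM _ fun v => ?_
    rw [abs_div, abs_two, div_le_one two_pos]
    refine (abs_add_le _ _).trans ?_
    rw [abs_mul, hχ, ht1]
    linarith
  have hcoeff : q.coeff 1 = ∑ v, |g v| := by
    simp only [← htg]
    rw [hq, finsetSum_coeff]
    simp only [coeff_C_mul, coeff_one_prod_affine, hg, Finset.mul_sum]
    rw [Finset.sum_comm]
    refine Finset.sum_congr rfl fun S _ => ?_
    rw [← Finset.sum_filter_add_sum_filter_not Finset.univ (fun v => v ∈ S)]
    rw [Finset.sum_eq_zero (s := Finset.univ.filter fun v => v ∉ S), add_zero]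
    · refine Finset.sum_congr (by ext; simp) fun v hv => ?_
      rw [if_pos (by simpa using hv)]
      ring
    · intro v hv
      rw [if_neg (by simpa using hv), mul_zero]
  have h := abs_coeff_one_le k q M hdegq heval
  rw [hcoeff] at h
  exact (le_abs_self _).trans h

/-- A multilinear polynomial of degree at most `k + 1` in which every variable occurs in at most
`D` monomials has an `ℓ¹` norm of coefficients bounded by its maximum on the cube. -/
theorem sum_abs_coeff_le (k D : ℕ) (c : Finset V → ℝ) (hdeg : ∀ S, k + 1 < S.card → c S = 0)
    (hD : ∀ v, (Finset.univ.filter fun S : Finset V => v ∈ S ∧ c S ≠ 0).card ≤ D)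
    (M : ℝ) (hM : ∀ y : V → ℝ, (∀ v, |y v| ≤ 1) → |∑ S, c S * ∏ v ∈ S, y v| ≤ M) :
    ∑ S ∈ Finset.univ.erase ∅, |c S| ≤ 2 ^ (k + 1) * 3 ^ (k + 1) * 5 ^ k * √D * M := by
  set b : V → Finset V → ℝ := fun v S => if v ∈ S then c S / 2 ^ S.card else 0 with hb
  have h1 : ∀ v, ∑ S, |b v S| ≤ √D * √(∑ S, b v S ^ 2) := by
    intro v
    rw [← Real.sqrt_mul (Nat.cast_nonneg D)]
    refine Real.le_sqrt_of_sq_le ?_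
    have e : ∑ S, |b v S| = ∑ S ∈ Finset.univ.filter (fun S => v ∈ S ∧ c S ≠ 0), |b v S| := by
      symm
      refine Finset.sum_subset (Finset.subset_univ _) fun S _ hS => ?_
      simp only [Finset.mem_filter, Finset.mem_univ, true_and, not_and, not_not] at hS
      by_cases h : v ∈ S
      · simp [hb, hS h]
      · simp [hb, h]
    rw [e]
    refine sq_sum_le_card_mul_sum_sq.trans ?_
    simp only [sq_abs]
    gcongr
    · exact hD v
    · exact Finset.subset_univ _
  have h2 : ∀ v, 2 ^ Fintype.card V * √(∑ S, b v S ^ 2)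
      ≤ 3 ^ (k + 1) * ∑ T, |multilin Finset.univ (b v) (signAt T)| := by
    intro v
    have := sqrt_sum_sq_le_sum_abs Finset.univ (k + 1) (b v) fun S hS => by simp [hb, hdeg S hS]
    simpa using this
  -- Each nonempty `S` is seen from one of its variables, and `2^(k+1)` undoes the weight
  -- `2^(-|S|)`. The constant term is invisible to the gradient.
  have h3 : ∑ S ∈ Finset.univ.erase ∅, |c S| ≤ 2 ^ (k + 1) * ∑ v, ∑ S, |b v S| := by
    rw [Finset.sum_comm, Finset.mul_sum]
    refine (Finset.sum_le_sum fun S hS => ?_).trans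
      (Finset.sum_le_sum_of_subset_of_nonneg (Finset.erase_subset _ _) fun S _ _ =>
        mul_nonneg (by positivity) (Finset.sum_nonneg fun _ _ => abs_nonneg _))
    obtain ⟨v, hv⟩ := Finset.nonempty_iff_ne_empty.2 (Finset.ne_of_mem_erase hS)
    have h4 : |b v S| ≤ ∑ v, |b v S| :=
      Finset.single_le_sum (f := fun v => |b v S|) (fun _ _ => abs_nonneg _) (Finset.mem_univ v)
    refine le_trans ?_ (mul_le_mul_of_nonneg_left h4 (by positivity))
    rcases Nat.lt_or_ge (k + 1) S.card with h | h
    · simp [hb, hdeg S h]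
    · simp only [hb, if_pos hv, abs_div, abs_pow, abs_two]
      rw [mul_div_assoc', le_div_iff₀ (by positivity), mul_comm]
      gcongr
      norm_num
  have h5 : ∑ T : Finset V, ∑ v, |multilin Finset.univ (b v) (signAt T)|
      ≤ 2 ^ Fintype.card V * (5 ^ k * M) := by
    refine (Finset.sum_le_card_nsmul _ _ _ fun T _ => sum_abs_gradient_le k c hdeg M hM T).trans ?_
    simp
  have hN : (0 : ℝ) < 2 ^ Fintype.card V := by positivity
  have h6 : ∑ v, √(∑ S, b v S ^ 2) ≤ 3 ^ (k + 1) * (5 ^ k * M) := by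
    refine le_of_mul_le_mul_left ?_ hN
    rw [Finset.mul_sum]
    refine (Finset.sum_le_sum fun v _ => h2 v).trans ?_
    rw [← Finset.mul_sum, Finset.sum_comm]
    refine (mul_le_mul_of_nonneg_left h5 (by positivity)).trans (le_of_eq (by ring))
  calc _ ≤ _ := h3
    _ ≤ 2 ^ (k + 1) * ∑ v, √D * √(∑ S, b v S ^ 2) := by
        gcongr with v; exact h1 v
    _ ≤ 2 ^ (k + 1) * (√D * (3 ^ (k + 1) * (5 ^ k * M))) := by
        rw [← Finset.mul_sum]; gcongr
    _ = _ := by ring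

end Cube

/-! ### Product states -/

/-- The tensor product `M₁ ⊗ ⋯ ⊗ Mₙ` of single-qubit operators. -/
noncomputable def tensorOp {n : ℕ} (M : Fin n → Matrix (Fin 2) (Fin 2) ℂ) : QubitOp n :=
  Matrix.of fun x y => ∏ i, M i (x i) (y i)

theorem pauliString_eq_tensorOp {n : ℕ} (P : Fin n → Fin 4) :
    pauliString P = tensorOp fun i => pauliMatrix (P i) := rfl

theorem tensorOp_mul {n : ℕ} (M N : Fin n → Matrix (Fin 2) (Fin 2) ℂ) :
    tensorOp M * tensorOp N = tensorOp fun i => M i * N i := by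
  ext x y
  simp only [tensorOp, Matrix.mul_apply, Matrix.of_apply, ← Finset.prod_mul_distrib]
  exact (Fintype.prod_sum fun i b => M i (x i) b * N i b (y i)).symm

theorem trace_tensorOp {n : ℕ} (M : Fin n → Matrix (Fin 2) (Fin 2) ℂ) :
    (tensorOp M).trace = ∏ i, (M i).trace := by
  simp only [tensorOp, Matrix.trace, Matrix.diag_apply, Matrix.of_apply]
  exact (Fintype.prod_sum fun i a => M i a a).symm

theorem conjTranspose_tensorOp {n : ℕ} (M : Fin n → Matrix (Fin 2) (Fin 2) ℂ) :
    (tensorOp M).conjTranspose = tensorOp fun i => (M i).conjTranspose := by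
  ext x y
  simp [tensorOp, Matrix.conjTranspose_apply]

theorem pauliMatrix_isHermitian (p : Fin 4) : (pauliMatrix p).IsHermitian := by
  ext x y
  fin_cases p <;> fin_cases x <;> fin_cases y <;> simp [pauliMatrix]

theorem pauliString_isHermitian {n : ℕ} (P : Fin n → Fin 4) : (pauliString P).IsHermitian := by
  rw [Matrix.IsHermitian, pauliString_eq_tensorOp, conjTranspose_tensorOp]
  congr 1
  funext i
  exact pauliMatrix_isHermitian (P i)

theorem ofReal_re_pauliCoeff {n : ℕ} {H : QubitOp n} (hH : H.IsHermitian) (P : Fin n → Fin 4) :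
    ((pauliCoeff H P).re : ℂ) = pauliCoeff H P := by
  refine Complex.conj_eq_iff_re.1 ?_
  rw [pauliCoeff, map_div₀, starRingEnd_apply, ← Matrix.trace_conjTranspose,
    Matrix.conjTranspose_mul, hH.eq, (pauliString_isHermitian P).eq, Matrix.trace_mul_comm, map_pow, Complex.conj_ofNat]

/-- The coordinates of the Pauli matrices in the state with Bloch vector `r`. -/
def blochCoord (r : Fin 3 → ℝ) : Fin 4 → ℝ := Fin.cons 1 r

/-- A square root of the density matrix with Bloch vector `r`. -/
theorem exists_sqrt_density (r : Fin 3 → ℝ) (hr : ∑ a, r a ^ 2 ≤ 1) :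
    ∃ B : Matrix (Fin 2) (Fin 2) ℂ, B.IsHermitian ∧
      ∀ p, (B * pauliMatrix p * B).trace = blochCoord r p := by
  rw [Fin.sum_univ_three] at hr
  -- The root has the form `B = u + w r·σ`. Requiring `B² = (1 + r·σ)/2` means `4uw = 1` and `2u² +
  -- 2w²|r|² = 1`, solved by `u² = (1 + s)/4`.
  set s := √(1 - (r 0 ^ 2 + r 1 ^ 2 + r 2 ^ 2)) with hs
  have hs0 : 0 ≤ s := Real.sqrt_nonneg _
  have hs2 : s ^ 2 = 1 - (r 0 ^ 2 + r 1 ^ 2 + r 2 ^ 2) := Real.sq_sqrt (by linarith)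
  set u := √((1 + s) / 4) with hu
  have hu0 : 0 < u := Real.sqrt_pos.2 (by linarith)
  have hu2 : u ^ 2 = (1 + s) / 4 := Real.sq_sqrt (by linarith)
  set w := 1 / (4 * u) with hw
  have huw : 4 * u * w = 1 := by rw [hw]; field_simp
  have hnorm : 2 * u ^ 2 + 2 * w ^ 2 * (r 0 ^ 2 + r 1 ^ 2 + r 2 ^ 2) = 1 := by
    have hw2 : w ^ 2 * (4 * (1 + s)) = 1 := by
      rw [show 4 * (1 + s) = 16 * u ^ 2 by rw [hu2]; ring]
      linear_combination (4 * u * w + 1) * huw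
    have : (1 + s) * (2 * u ^ 2 + 2 * w ^ 2 * (r 0 ^ 2 + r 1 ^ 2 + r 2 ^ 2)) = (1 + s) * 1 := by
      rw [hu2]
      linear_combination (1 / 2) * (r 0 ^ 2 + r 1 ^ 2 + r 2 ^ 2) * hw2 + (1 / 2) * hs2
    exact mul_left_cancel₀ (by linarith) this
  have huw' : (4 * u * w : ℂ) = 1 := by exact_mod_cast huw
  have hnorm' : (2 * u ^ 2 + 2 * w ^ 2 * (r 0 ^ 2 + r 1 ^ 2 + r 2 ^ 2) : ℂ) = 1 := by
    exact_mod_cast hnorm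
  have hI : Complex.I ^ 2 = -1 := Complex.I_sq
  refine ⟨!![(u : ℂ) + w * r 2, w * (r 0 - Complex.I * r 1);
    w * (r 0 + Complex.I * r 1), u - w * r 2], ?_, ?_⟩
  · ext x y
    fin_cases x <;> fin_cases y <;> simp [sub_eq_add_neg]
  · intro p
    fin_cases p
    · simp [pauliMatrix, blochCoord, Matrix.trace, Fin.sum_univ_two]
      linear_combination hnorm' - 2 * w ^ 2 * r 1 ^ 2 * hI
    · simp [pauliMatrix, blochCoord, Matrix.trace, Fin.sum_univ_two]
      linear_combination r 0 * huw'
    · simp [pauliMatrix, blochCoord, Matrix.trace, Fin.sum_univ_two]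
      change _ = (r 1 : ℂ)
      linear_combination r 1 * huw' - 4 * u * w * r 1 * hI
    · simp [pauliMatrix, blochCoord, Matrix.trace, Fin.sum_univ_two]
      change _ = (r 2 : ℂ)
      linear_combination r 2 * huw'

/-- The trace is the sum of `⟨b, H b⟩` over the columns `b` of `B`, and each term is at most `‖H‖
‖b‖²`. -/
theorem norm_trace_conjTranspose_mul_mul_le {ι : Type*} [Fintype ι] [DecidableEq ι]
    (H B : Matrix ι ι ℂ) :
    ‖(B.conjTranspose * H * B).trace‖ ≤ ‖H‖ * ‖(B.conjTranspose * B).trace‖ := by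
  set b : ι → EuclideanSpace ℂ ι := fun x => WithLp.toLp 2 (B.col x) with hb
  have h1 : (B.conjTranspose * H * B).trace
      = ∑ x, inner ℂ (b x) (WithLp.toLp 2 (H.mulVec (B.col x))) := by
    simp only [EuclideanSpace.inner_eq_star_dotProduct, hb, Matrix.trace, Matrix.diag_apply,
      Matrix.mul_assoc]
    refine Finset.sum_congr rfl fun x _ => ?_
    simp only [Matrix.mul_apply, dotProduct, Matrix.mulVec, Matrix.conjTranspose_apply,
      Matrix.col_apply, Pi.star_apply]
    exact Finset.sum_congr rfl fun y _ => mul_comm _ _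
  have h2 : (B.conjTranspose * B).trace = ((∑ x, ‖b x‖ ^ 2 : ℝ) : ℂ) := by
    rw [Complex.ofReal_sum]
    refine Finset.sum_congr rfl fun x _ => ?_
    rw [Complex.ofReal_pow]
    refine Eq.trans ?_ (inner_self_eq_norm_sq_to_K (𝕜 := ℂ) (b x))
    simp only [EuclideanSpace.inner_eq_star_dotProduct, hb, Matrix.diag_apply, Matrix.mul_apply,
      dotProduct, Matrix.conjTranspose_apply, Matrix.col_apply, Pi.star_apply]
    exact Finset.sum_congr rfl fun y _ => mul_comm _ _
  rw [h1, h2, Complex.norm_real,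
    Real.norm_of_nonneg (Finset.sum_nonneg fun x _ => sq_nonneg _), Finset.mul_sum]
  refine norm_sum_le_of_le _ fun x _ => (norm_inner_le_norm _ _).trans ?_
  have h3 : ‖WithLp.toLp 2 (H.mulVec (B.col x))‖ ≤ ‖H‖ * ‖b x‖ := Matrix.l2_opNorm_mulVec H (b x)
  calc _ ≤ ‖b x‖ * (‖H‖ * ‖b x‖) := by gcongr
    _ = _ := by ring

/-- The energy of a product state with Bloch vectors `r i`. -/
theorem abs_sum_pauliCoeff_mul_bloch_le {n : ℕ} (H : QubitOp n) (r : Fin n → Fin 3 → ℝ)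
    (hr : ∀ i, ∑ a, r i a ^ 2 ≤ 1) :
    ‖∑ P, pauliCoeff H P * ((∏ i, blochCoord (r i) (P i) : ℝ) : ℂ)‖ ≤ ‖H‖ := by
  choose B hB hBp using fun i => exists_sqrt_density (r i) (hr i)
  have hBt : (tensorOp B).conjTranspose = tensorOp B := by
    rw [conjTranspose_tensorOp]
    congr 1
    funext i
    exact hB i
  have htr : ∀ P, (tensorOp B * pauliString P * tensorOp B).trace
      = ((∏ i, blochCoord (r i) (P i) : ℝ) : ℂ) := by
    intro P
    rw [pauliString_eq_tensorOp, tensorOp_mul, tensorOp_mul, trace_tensorOp, Complex.ofReal_prod]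
    exact Finset.prod_congr rfl fun i _ => hBp i (P i)
  have h1 : (tensorOp B * tensorOp B).trace = 1 := by
    rw [tensorOp_mul, trace_tensorOp]
    refine Finset.prod_eq_one fun i _ => ?_
    have := hBp i 0
    simpa [pauliMatrix, blochCoord] using this
  have h := norm_trace_conjTranspose_mul_mul_le H (tensorOp B)
  rw [hBt, h1, norm_one, mul_one] at h
  convert h using 2
  conv_rhs => rw [← sum_pauliCoeff H]
  rw [Finset.mul_sum, Finset.sum_mul, Matrix.trace_sum]
  refine Finset.sum_congr rfl fun P _ => ?_
  rw [Matrix.mul_smul, Matrix.smul_mul, Matrix.trace_smul, htr, smul_eq_mul]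

/-! ### Locality and the Pauli expansion -/

theorem pauliMatrix_add_one_diag {p : Fin 4} (hp : p ≠ 0) (a : Fin 2) :
    pauliMatrix p (a + 1) (a + 1) = -pauliMatrix p a a := by
  fin_cases p <;> fin_cases a <;> simp [pauliMatrix] at hp ⊢

/-- An operator acting only on `S` has no Pauli component acting outside `S`. -/
theorem pauliCoeff_eq_zero {n : ℕ} {S : Finset (Fin n)} {M : QubitOp n} (hM : ActsOnlyOn S M)
    {P : Fin n → Fin 4} {i : Fin n} (hi : i ∉ S) (hP : P i ≠ 0) : pauliCoeff M P = 0 := by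
  obtain ⟨A, hA⟩ := hM
  -- Flipping bit `i` preserves `M`, which is the identity there, and negates every contributing
  -- term of the trace. So the trace equals its own negative.
  set e : (Fin n → Fin 2) ≃ (Fin n → Fin 2) := Equiv.addRight (Pi.single i 1) with he
  have hei : ∀ x, e x i = x i + 1 := by intro x; simp [he]
  have hej : ∀ x j, j ≠ i → e x j = x j := by intro x j hj; simp [he, hj]
  have hMe : ∀ x y, M (e x) (e y) = M x y := by
    intro x y
    have hS : ∀ x, (fun j : S => e x j) = fun j : S => x j := by
      intro x
      funext j
      exact hej x j fun h => hi (h ▸ j.2)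
    rw [hA, hA, hS, hS]
    refine if_congr (forall₂_congr fun j _ => ?_) rfl rfl
    rcases eq_or_ne j i with rfl | hj
    · rw [hei, hei, add_left_inj]
    · rw [hej _ _ hj, hej _ _ hj]
  have hterm : ∀ x y, pauliString P (e x) (e y) * M (e y) (e x)
      = -(pauliString P x y * M y x) := by
    intro x y
    rw [hMe]
    by_cases hxy : y i = x i
    · rw [← neg_mul]
      congr 1
      simp only [pauliString, Matrix.of_apply]
      rw [← Finset.mul_prod_erase _ _ (Finset.mem_univ i),
        ← Finset.mul_prod_erase _ _ (Finset.mem_univ i), ← neg_mul, hei, hei, hxy,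
        pauliMatrix_add_one_diag hP]
      congr 1
      refine Finset.prod_congr rfl fun j hj => ?_
      rw [hej _ _ (Finset.ne_of_mem_erase hj), hej _ _ (Finset.ne_of_mem_erase hj)]
    · rw [hA y x, if_neg fun h => hxy (h i hi), mul_zero, mul_zero, neg_zero]
  have h : (pauliString P * M).trace = -(pauliString P * M).trace := by
    simp only [Matrix.trace, Matrix.diag_apply, Matrix.mul_apply]
    conv_lhs => rw [← e.sum_comp]
    rw [← Finset.sum_neg_distrib]
    refine Finset.sum_congr rfl fun x _ => ?_
    rw [← e.sum_comp, ← Finset.sum_neg_distrib]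
    exact Finset.sum_congr rfl fun y _ => hterm x y
  rw [pauliCoeff, self_eq_neg.1 h, zero_div]

/-- The pairs of a qubit and a Pauli matrix `X, Y, Z` that occur in a Pauli string. -/
def pauliSupport {n : ℕ} (P : Fin n → Fin 4) : Finset (Fin n × Fin 3) :=
  Finset.univ.filter fun v => P v.1 = v.2.succ

theorem pauliSupport_injective {n : ℕ} :
    Function.Injective (pauliSupport : (Fin n → Fin 4) → Finset (Fin n × Fin 3)) := by
  intro P Q h
  have h' : ∀ i a, P i = Fin.succ a ↔ Q i = Fin.succ a := by
    intro i a
    have := Finset.ext_iff.1 h (i, a)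
    simpa [pauliSupport] using this
  funext i
  rcases Fin.eq_zero_or_eq_succ (P i) with hP | ⟨a, hP⟩
  · rcases Fin.eq_zero_or_eq_succ (Q i) with hQ | ⟨a, hQ⟩
    · rw [hP, hQ]
    · rw [(h' i a).2 hQ, hQ]
  · rw [hP, (h' i a).1 hP]

theorem pauliSupport_card {n : ℕ} (P : Fin n → Fin 4) :
    (pauliSupport P).card = (Finset.univ.filter fun i => P i ≠ 0).card := by
  refine Finset.card_bij (fun v _ => v.1) ?_ ?_ ?_
  · intro v hv
    simp only [pauliSupport, Finset.mem_filter, Finset.mem_univ, true_and] at hv ⊢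
    rw [hv]; exact Fin.succ_ne_zero _
  · rintro ⟨i, a⟩ hv ⟨j, b⟩ hw (rfl : i = j)
    simp only [pauliSupport, Finset.mem_filter, Finset.mem_univ, true_and] at hv hw
    rw [Fin.succ_injective _ (hv.symm.trans hw)]
  · intro i hi
    obtain ⟨a, ha⟩ := Fin.exists_succ_eq.2 (Finset.mem_filter.1 hi).2
    exact ⟨(i, a), by simp [pauliSupport, ha], rfl⟩

theorem prod_pauliSupport {n : ℕ} (P : Fin n → Fin 4) (y : Fin n × Fin 3 → ℝ) :
    ∏ v ∈ pauliSupport P, y v = ∏ i, blochCoord (fun a => y (i, a)) (P i) := by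
  rw [pauliSupport, Finset.prod_filter, Fintype.prod_prod_type]
  refine Finset.prod_congr rfl fun i _ => ?_
  rcases Fin.eq_zero_or_eq_succ (P i) with hP | ⟨a, hP⟩
  · simp [hP, blochCoord, (Fin.succ_ne_zero _).symm]
  · simp [hP, blochCoord, Fin.succ_inj]

section Local
variable {n k d : ℕ} {H : QubitOp n}

theorem IsLocalHamiltonian.isHermitian (hH : IsLocalHamiltonian k d H) : H.IsHermitian := by
  obtain ⟨m, h, S, rfl, hh, -⟩ := hH
  rw [Matrix.IsHermitian, Matrix.conjTranspose_sum]
  exact Finset.sum_congr rfl fun j _ => hh j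

theorem pauliCoeff_sum {m : ℕ} (h : Fin m → QubitOp n) (P : Fin n → Fin 4) :
    pauliCoeff (∑ j, h j) P = ∑ j, pauliCoeff (h j) P := by
  simp only [pauliCoeff, Matrix.mul_sum, Matrix.trace_sum, Finset.sum_div]

theorem exists_support_subset {m : ℕ} {h : Fin m → QubitOp n} {S : Fin m → Finset (Fin n)}
    (hS : ∀ j, ActsOnlyOn (S j) (h j)) {P : Fin n → Fin 4} (hP : pauliCoeff (∑ j, h j) P ≠ 0) :
    ∃ j, ∀ i, P i ≠ 0 → i ∈ S j := by
  by_contra! hcon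
  refine hP ?_
  rw [pauliCoeff_sum]
  refine Finset.sum_eq_zero fun j _ => ?_
  obtain ⟨i, hi, hiS⟩ := hcon j
  exact pauliCoeff_eq_zero (hS j) hiS hi

theorem IsLocalHamiltonian.card_pauliSupport_le (hH : IsLocalHamiltonian k d H)
    {P : Fin n → Fin 4} (hP : pauliCoeff H P ≠ 0) : (pauliSupport P).card ≤ k := by
  obtain ⟨m, h, S, rfl, -, hS, hk, -⟩ := hH
  obtain ⟨j, hj⟩ := exists_support_subset hS hP
  rw [pauliSupport_card]
  exact (Finset.card_le_card fun i hi => hj i (Finset.mem_filter.1 hi).2).trans (hk j)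

/-- Qubit `i` is pinned to `p`, the other qubits of `S` are free, and those outside carry the
identity. -/
theorem card_pauli_on_le {S : Finset (Fin n)} {i : Fin n} (hi : i ∈ S) (p : Fin 4) :
    (Finset.univ.filter fun P : Fin n → Fin 4 => P i = p ∧ ∀ l, P l ≠ 0 → l ∈ S).card
      ≤ 4 ^ (S.card - 1) := by
  set F : Fin n → Finset (Fin 4) := fun l =>
    if l = i then {p} else if l ∈ S then Finset.univ else {0} with hF
  have hsub : (Finset.univ.filter fun P : Fin n → Fin 4 => P i = p ∧ ∀ l, P l ≠ 0 → l ∈ S)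
      ⊆ Fintype.piFinset F := by
    intro P hP
    obtain ⟨hp, hPS⟩ := (Finset.mem_filter.1 hP).2
    rw [Fintype.mem_piFinset]
    intro l
    simp only [hF]
    split_ifs with h1 h2
    · rw [h1, hp, Finset.mem_singleton]
    · exact Finset.mem_univ _
    · rw [Finset.mem_singleton]
      by_contra h
      exact h2 (hPS l h)
  refine (Finset.card_le_card hsub).trans (le_of_eq ?_)
  have hcard : ∀ l, (F l).card = if l ∈ S.erase i then 4 else 1 := by
    intro l
    simp only [hF, Finset.mem_erase]
    by_cases h1 : l = i <;> by_cases h2 : l ∈ S <;> simp [h1, h2]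
  rw [Fintype.card_piFinset, Finset.prod_congr rfl fun l _ => hcard l, Finset.prod_ite_mem,
    Finset.univ_inter, Finset.prod_const, Finset.card_erase_of_mem hi]

theorem IsLocalHamiltonian.card_pauli_le (hH : IsLocalHamiltonian (k + 1) d H)
    (v : Fin n × Fin 3) :
    (Finset.univ.filter fun P : Fin n → Fin 4 => v ∈ pauliSupport P ∧ pauliCoeff H P ≠ 0).card
      ≤ d * 4 ^ k := by
  obtain ⟨m, h, S, rfl, -, hS, hk, hd⟩ := hH
  obtain ⟨i, a⟩ := v
  have hsub : (Finset.univ.filter fun P : Fin n → Fin 4 =>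
      (i, a) ∈ pauliSupport P ∧ pauliCoeff (∑ j, h j) P ≠ 0)
      ⊆ (Finset.univ.filter fun j => i ∈ S j).biUnion fun j =>
        Finset.univ.filter fun P : Fin n → Fin 4 => P i = a.succ ∧ ∀ l, P l ≠ 0 → l ∈ S j := by
    intro P hP
    obtain ⟨hv, hP0⟩ := (Finset.mem_filter.1 hP).2
    have hPi : P i = a.succ := (Finset.mem_filter.1 hv).2
    obtain ⟨j, hj⟩ := exists_support_subset hS hP0
    have hij : i ∈ S j := hj i (by rw [hPi]; exact Fin.succ_ne_zero a)
    simp only [Finset.mem_biUnion, Finset.mem_filter, Finset.mem_univ, true_and]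
    exact ⟨j, hij, hPi, hj⟩
  refine (Finset.card_le_card hsub).trans (Finset.card_biUnion_le.trans ?_)
  refine (Finset.sum_le_card_nsmul _ _ (4 ^ k) fun j hj => ?_).trans ?_
  · refine (card_pauli_on_le (Finset.mem_filter.1 hj).2 _).trans ?_
    exact Nat.pow_le_pow_right (by norm_num) (by have := hk j; omega)
  · rw [smul_eq_mul]
    exact Nat.mul_le_mul_right _ (hd i)

/-- The maximally mixed state, with all Bloch vectors zero, sees only the identity coefficient. This
supplies the term that the gradient argument misses. -/
theorem norm_pauliCoeff_zero_le (H : QubitOp n) : ‖pauliCoeff H 0‖ ≤ ‖H‖ := by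
  have h := abs_sum_pauliCoeff_mul_bloch_le H 0 (by simp)
  rw [Finset.sum_eq_single 0] at h
  · simpa [blochCoord] using h
  · intro P _ hP
    obtain ⟨i, hi⟩ := Function.ne_iff.1 hP
    obtain ⟨a, ha⟩ := Fin.exists_succ_eq.2 hi
    rw [Finset.prod_eq_zero (Finset.mem_univ i), Complex.ofReal_zero, mul_zero]
    simp [← ha, blochCoord]
  · simp

theorem IsLocalHamiltonian.sum_norm_pauliCoeff_le (hH : IsLocalHamiltonian (k + 1) d H) :
    ∑ P ∈ Finset.univ.erase 0, ‖pauliCoeff H P‖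
      ≤ 2 ^ (k + 1) * 3 ^ (k + 1) * 5 ^ k * √(d * 4 ^ k : ℕ) * √3 ^ (k + 1) * ‖H‖ := by
  set α : (Fin n → Fin 4) → ℝ := fun P => (pauliCoeff H P).re with hα
  have hα' : ∀ P, (α P : ℂ) = pauliCoeff H P := ofReal_re_pauliCoeff hH.isHermitian
  have hα0 : ∀ P, α P = 0 → pauliCoeff H P = 0 := fun P h => by rw [← hα', h, Complex.ofReal_zero]
  have hαn : ∀ P, ‖pauliCoeff H P‖ = |α P| := fun P => by rw [← hα', Complex.norm_real]; rfl
  -- Coefficients in the rescaled variables: each factor `1/√3` comes from fitting the cube into the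
  -- Bloch ball, and sets containing two Paulis on one qubit get 0.
  set c : Finset (Fin n × Fin 3) → ℝ := fun S =>
    Function.extend pauliSupport α 0 S * (1 / √3) ^ S.card with hc
  have hcP : ∀ P, c (pauliSupport P) = α P * (1 / √3) ^ (pauliSupport P).card := by
    intro P
    simp only [hc, pauliSupport_injective.extend_apply]
  have hc0 : ∀ S, S ∉ Set.range (pauliSupport (n := n)) → c S = 0 := by
    intro S hS
    simp only [hc]
    rw [Function.extend_apply' _ _ _ (by simpa using hS)]
    simp
  have h3 : 1 ≤ √3 := Real.one_le_sqrt.2 (by norm_num)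
  have hcard : ∀ P, α P ≠ 0 → (pauliSupport P).card ≤ k + 1 := fun P hP =>
    hH.card_pauliSupport_le (by rw [← hα']; exact_mod_cast hP)
  have hdeg : ∀ S, k + 1 < S.card → c S = 0 := by
    intro S hS
    by_cases hr : S ∈ Set.range (pauliSupport (n := n))
    · obtain ⟨P, rfl⟩ := hr
      rw [hcP]
      by_cases hP : α P = 0
      · rw [hP, zero_mul]
      · have := hcard P hP
        omega
    · exact hc0 S hr
  have hD : ∀ v, (Finset.univ.filter fun S => v ∈ S ∧ c S ≠ 0).card ≤ d * 4 ^ k := by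
    intro v
    refine le_trans (le_trans (Finset.card_le_card ?_) (Finset.card_image_le (f := pauliSupport)))
      (hH.card_pauli_le v)
    intro S hS
    obtain ⟨hv, hcS⟩ := (Finset.mem_filter.1 hS).2
    obtain ⟨P, rfl⟩ : S ∈ Set.range (pauliSupport (n := n)) := by
      by_contra h
      exact hcS (hc0 S h)
    refine Finset.mem_image_of_mem _ (Finset.mem_filter.2 ⟨Finset.mem_univ _, hv, ?_⟩)
    rw [hcP] at hcS
    rw [← hα']
    exact_mod_cast left_ne_zero_of_mul hcS
  have hM : ∀ y : Fin n × Fin 3 → ℝ, (∀ v, |y v| ≤ 1) → |∑ S, c S * ∏ v ∈ S, y v| ≤ ‖H‖ := by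
    intro y hy
    have h := abs_sum_pauliCoeff_mul_bloch_le H (fun i a => 1 / √3 * y (i, a)) (by
      intro i
      have : ∀ a, (1 / √3 * y (i, a)) ^ 2 ≤ 1 / 3 := by
        intro a
        rw [mul_pow, div_pow, Real.sq_sqrt (by norm_num), one_pow]
        have := (sq_le_one_iff_abs_le_one _).2 (hy (i, a))
        linarith
      refine (Finset.sum_le_sum fun a _ => this a).trans ?_
      simp)
    have e : ∑ P, pauliCoeff H P * ((∏ i, blochCoord (fun a => 1 / √3 * y (i, a)) (P i) : ℝ) : ℂ)
        = ((∑ S, c S * ∏ v ∈ S, y v : ℝ) : ℂ) := by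
      rw [← Fintype.sum_of_injective pauliSupport pauliSupport_injective
        (fun P => α P * ∏ i, blochCoord (fun a => 1 / √3 * y (i, a)) (P i))]
      · push_cast
        simp only [hα']
      · intro S hS
        rw [hc0 S hS, zero_mul]
      · intro P
        rw [hcP, ← prod_pauliSupport P fun v => 1 / √3 * y v, Finset.prod_mul_distrib,
          Finset.prod_const, mul_assoc]
    rwa [e, Complex.norm_real] at h
  have main := sum_abs_coeff_le k (d * 4 ^ k) c hdeg hD ‖H‖ hM
  have hempty : pauliSupport (0 : Fin n → Fin 4) = ∅ := by
    simp [pauliSupport, (Fin.succ_ne_zero _).symm]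
  have hsum : ∑ P ∈ Finset.univ.erase 0, |α P|
      ≤ √3 ^ (k + 1) * ∑ S ∈ Finset.univ.erase ∅, |c S| := by
    have h1 : ∀ P, |α P| ≤ √3 ^ (k + 1) * |c (pauliSupport P)| := by
      intro P
      by_cases hP : α P = 0
      · rw [hP, abs_zero]; positivity
      · rw [hcP, abs_mul, abs_of_pos (by positivity : 0 < (1 / √3) ^ (pauliSupport P).card),
          one_div, inv_pow]
        have h2 : √3 ^ (pauliSupport P).card ≤ √3 ^ (k + 1) := pow_le_pow_right₀ h3 (hcard P hP)
        have h4 : 0 < √3 ^ (pauliSupport P).card := by positivity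
        rw [mul_left_comm, ← div_eq_mul_inv]
        exact le_mul_of_one_le_right (abs_nonneg _) ((one_le_div h4).2 h2)
    refine (Finset.sum_le_sum fun P _ => h1 P).trans ?_
    rw [← Finset.mul_sum, ← Finset.sum_image (f := fun S => |c S|) pauliSupport_injective.injOn]
    gcongr
    intro S hS
    obtain ⟨P, hP, rfl⟩ := Finset.mem_image.1 hS
    rw [Finset.mem_erase, ← hempty]
    exact ⟨fun h => Finset.ne_of_mem_erase hP (pauliSupport_injective h), Finset.mem_univ _⟩
  simp only [hαn]
  calc _ ≤ _ := hsum
    _ ≤ √3 ^ (k + 1) * (2 ^ (k + 1) * 3 ^ (k + 1) * 5 ^ k * √(d * 4 ^ k : ℕ) * ‖H‖) := by gcongr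
    _ = _ := by ring

end Local

/-! ### Comparison of constants -/

theorem factorial_mul_pow_le (k : ℕ) (hk : 1 ≤ k) :
    k.factorial * 78 ^ k ≤ 112 * k ^ (2 * k + 5) := by
  rcases Nat.lt_or_ge k 20 with h | h
  · interval_cases k <;> norm_num [Nat.factorial]
  · induction k, h using Nat.le_induction with
    | base => norm_num [Nat.factorial]
    | succ k hk20 ih =>
      -- From `k` to `k + 1` the left side gains `78(k + 1)`, the right at least `2 * 2 * 20 * (k +
      -- 1)`, by Bernoulli used twice and `k + 1 ≥ 20`.
      have hbern : 2 * k ^ k ≤ (k + 1) ^ k := by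
        have hk0 : (0 : ℝ) < k := by exact_mod_cast (by omega : 0 < k)
        have h := one_add_mul_le_pow (a := 1 / (k : ℝ)) (by have := one_div_pos.2 hk0; linarith) k
        rw [mul_one_div_cancel hk0.ne', one_add_div hk0.ne', div_pow, le_div_iff₀ (by positivity)] at h
        have h' : (2 : ℝ) * k ^ k ≤ (k + 1) ^ k := by linarith
        exact_mod_cast h'
      have h6 : 20 * k ^ 5 ≤ (k + 1) ^ 6 := by
        rw [pow_succ, mul_comm]
        exact Nat.mul_le_mul (Nat.pow_le_pow_left (by omega) 5) (by omega)
      calc (k + 1).factorial * 78 ^ (k + 1)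
          = (k + 1) * 78 * (k.factorial * 78 ^ k) := by rw [Nat.factorial_succ, pow_succ]; ring
        _ ≤ (k + 1) * 78 * (112 * k ^ (2 * k + 5)) := Nat.mul_le_mul_left _ (ih (by omega))
        _ ≤ 112 * (k + 1) * ((2 * k ^ k) * (2 * k ^ k) * (20 * k ^ 5)) := by
            rw [two_mul k, pow_add, pow_add]
            nlinarith [Nat.zero_le ((k + 1) * (k ^ k * k ^ k * k ^ 5))]
        _ ≤ 112 * (k + 1) * ((k + 1) ^ k * (k + 1) ^ k * (k + 1) ^ 6) := by gcongr
        _ = 112 * (k + 1) ^ (2 * (k + 1) + 5) := by ring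

theorem normConst_pos (k d : ℕ) (hk : 1 ≤ k) (hd : 1 ≤ d) : 0 < normConst k d := by
  have h1 : (0 : ℝ) < k := by exact_mod_cast hk
  have h2 : (0 : ℝ) < d := by exact_mod_cast hd
  unfold normConst
  positivity

theorem normConst_mul_le (k d : ℕ) (hd : 1 ≤ d) :
    normConst (k + 1) d * (1 + 2 ^ (k + 1) * 3 ^ (k + 1) * 5 ^ k * √(d * 4 ^ k : ℕ) * √3 ^ (k + 1))
      ≤ 3 := by
  have hd1 : 1 ≤ √(d : ℝ) := Real.one_le_sqrt.2 (by exact_mod_cast hd)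
  have h3 : 1 ≤ √3 := Real.one_le_sqrt.2 (by norm_num)
  have e1 : √(d * 4 ^ k : ℕ) = √(d : ℝ) * 2 ^ k := by
    rw [Nat.cast_mul, Real.sqrt_mul (Nat.cast_nonneg d), Nat.cast_pow]
    congr 1
    rw [show ((4 : ℕ) : ℝ) ^ k = (2 ^ k) ^ 2 by rw [← pow_mul, mul_comm, pow_mul]; norm_num]
    exact Real.sqrt_sq (by positivity)
  have e2 : (2 : ℝ) ^ (k + 1) * 3 ^ (k + 1) * 5 ^ k * (√(d : ℝ) * 2 ^ k) * √3 ^ (k + 1)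
      = √(d : ℝ) * 60 ^ (k + 1) * √3 ^ (k + 1) / 10 := by
    rw [show (60 : ℝ) = 2 * 3 * 5 * 2 by norm_num, mul_pow, mul_pow, mul_pow, pow_succ 5 k,
      pow_succ 2 k]
    ring
  rw [e1, e2]
  set m := k + 1 with hm
  have hm0 : (0 : ℝ) < m := by rw [hm]; positivity
  set R : ℝ := (m : ℝ) ^ ((m : ℝ) + 5 / 2) with hR
  have hR0 : 0 < R := by positivity
  have hR2 : R ^ 2 = (m : ℝ) ^ (2 * m + 5) := by
    rw [hR, ← Real.rpow_natCast, ← Real.rpow_mul hm0.le, ← Real.rpow_natCast]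
    congr 1
    push_cast
    ring
  have hfac : (m.factorial : ℝ) * 78 ^ m ≤ 112 * R ^ 2 := by
    rw [hR2]
    exact_mod_cast factorial_mul_pow_le m (by omega)
  -- Here `34/5` is a rational lower bound for `(2√6 + 4√3)/√3 = 4 + 2√2`. The numbers fit since
  -- `60² ≤ 78 (34/5)²` and `2 * 112 ≤ 15²`.
  have hroot : √(2 * (m.factorial : ℝ)) * 60 ^ m ≤ 15 * (R * (34 / 5) ^ m) := by
    refine abs_le_of_sq_le_sq' ?_ (by positivity) |>.2
    rw [mul_pow, Real.sq_sqrt (by positivity)]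
    have h78 : ((60 : ℝ) ^ m) ^ 2 ≤ 78 ^ m * ((34 / 5) ^ m) ^ 2 := by
      rw [← pow_mul, ← pow_mul, mul_comm m 2, pow_mul, pow_mul, ← mul_pow]
      gcongr
      norm_num
    calc 2 * (m.factorial : ℝ) * (60 ^ m) ^ 2
        ≤ 2 * (m.factorial : ℝ) * (78 ^ m * ((34 / 5) ^ m) ^ 2) := by gcongr
      _ = 2 * ((m.factorial : ℝ) * 78 ^ m) * ((34 / 5) ^ m) ^ 2 := by ring
      _ ≤ 2 * (112 * R ^ 2) * ((34 / 5) ^ m) ^ 2 := by gcongr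
      _ ≤ (15 * (R * (34 / 5) ^ m)) ^ 2 := by
          have : 0 ≤ R ^ 2 * ((34 / 5) ^ m) ^ 2 := by positivity
          linarith
  have hc : 34 / 5 * √3 ≤ 2 * √6 + 4 * √3 := by
    have h6 : √6 = √2 * √3 := by rw [← Real.sqrt_mul (by norm_num)]; norm_num
    have h2 : 7 / 5 ≤ √2 := Real.le_sqrt_of_sq_le (by norm_num)
    rw [h6]
    nlinarith
  have h60 : (60 : ℝ) ≤ 60 ^ m := le_self_pow₀ (by norm_num) (by omega)
  have h3m : 1 ≤ √3 ^ m := one_le_pow₀ h3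
  have hbig : 60 ≤ √(d : ℝ) * 60 ^ m * √3 ^ m := by
    calc (60 : ℝ) = 1 * 60 * 1 := by norm_num
      _ ≤ _ := by gcongr
  unfold normConst
  rw [← hR, div_mul_eq_mul_div, div_le_iff₀ (by positivity)]
  calc √(2 * (m.factorial : ℝ)) * (1 + √(d : ℝ) * 60 ^ m * √3 ^ m / 10)
      -- By `hbig` the summand 1, from the identity coefficient, is absorbed by doubling the other
      -- term.
      ≤ √(2 * (m.factorial : ℝ)) * (√(d : ℝ) * 60 ^ m * √3 ^ m / 5) := by
        gcongr; linarith
    _ = √(2 * (m.factorial : ℝ)) * 60 ^ m * (√(d : ℝ) * √3 ^ m / 5) := by ring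
    _ ≤ 15 * (R * (34 / 5) ^ m) * (√(d : ℝ) * √3 ^ m / 5) := by gcongr
    _ = 3 * (√(d : ℝ) * R * (34 / 5 * √3) ^ m) := by rw [mul_pow]; ring
    _ ≤ _ := by gcongr

/-- Since `k! ≤ k^k`, the square root of the factorial cancels at most about half of `k log k`, so
the exponent keeps that order. -/
theorem exists_normConst_eq : ∃ g : ℕ → ℝ,
      g =Θ[atTop] (fun k : ℕ => (k : ℝ) * Real.log (k : ℝ)) ∧
      ∀ k d : ℕ, 1 ≤ k → 1 ≤ d →
        normConst k d = 1 / (√(d : ℝ) * Real.exp (g k)) := by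
  set c : ℝ := 2 * √6 + 4 * √3 with hc
  have hc1 : 1 ≤ c := by
    have : 1 ≤ √3 := Real.one_le_sqrt.2 (by norm_num)
    have := Real.sqrt_nonneg 6
    linarith
  have hlc : 0 ≤ Real.log c := Real.log_nonneg hc1
  have bounds : ∀ k : ℕ, 3 ≤ k → 0 ≤ k * Real.log k ∧
      1 / 2 * (k * Real.log k) ≤ ((k : ℝ) + 5 / 2) * Real.log k + k * Real.log c
        - Real.log (2 * k.factorial) / 2 ∧
      ((k : ℝ) + 5 / 2) * Real.log k + k * Real.log c - Real.log (2 * k.factorial) / 2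
        ≤ (7 / 2 + Real.log c) * (k * Real.log k) := by
    intro k hk
    have hk' : (3 : ℝ) ≤ k := by exact_mod_cast hk
    have hl : 1 ≤ Real.log k := by
      rw [Real.le_log_iff_exp_le (by linarith)]
      have := Real.exp_one_lt_d9
      linarith
    have hf1 : (1 : ℝ) ≤ k.factorial := by exact_mod_cast k.factorial_pos
    have hf0 : 0 ≤ Real.log (2 * k.factorial) := Real.log_nonneg (by linarith)
    have hf2 : Real.log (2 * k.factorial) ≤ 1 + k * Real.log k := by
      rw [Real.log_mul (by norm_num) (by positivity), ← Real.log_pow]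
      have := Real.log_two_lt_d9
      have : Real.log k.factorial ≤ Real.log ((k : ℝ) ^ k) :=
        Real.log_le_log (by linarith) (by exact_mod_cast k.factorial_le_pow)
      linarith
    have hkc : 0 ≤ k * Real.log c := by positivity
    refine ⟨by positivity, by linarith, ?_⟩
    have h1 : 0 ≤ (k - 1) * Real.log k := mul_nonneg (by linarith) (by linarith)
    have h2 : 0 ≤ k * Real.log c * (Real.log k - 1) := mul_nonneg hkc (by linarith)
    linarith
  refine ⟨fun k => ((k : ℝ) + 5 / 2) * Real.log k + k * Real.log c
    - Real.log (2 * k.factorial) / 2, ⟨?_, ?_⟩, ?_⟩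
  · refine IsBigO.of_bound (7 / 2 + Real.log c) ?_
    filter_upwards [eventually_ge_atTop 3] with k hk
    obtain ⟨h1, h2, h3⟩ := bounds k hk
    rwa [Real.norm_of_nonneg h1, Real.norm_of_nonneg (by linarith)]
  · refine IsBigO.of_bound 2 ?_
    filter_upwards [eventually_ge_atTop 3] with k hk
    obtain ⟨h1, h2, h3⟩ := bounds k hk
    rw [Real.norm_of_nonneg h1, Real.norm_of_nonneg (by linarith)]
    linarith
  · intro k d hk hd
    have h1 : (0 : ℝ) < k := by exact_mod_cast hk
    have h2 : (0 : ℝ) < 2 * k.factorial := by positivity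
    rw [Real.exp_sub, Real.exp_add, ← Real.log_rpow (by positivity), ← Real.log_pow,
      Real.exp_log (by positivity), Real.exp_log (by positivity), Real.exp_half,
      Real.exp_log h2]
    unfold normConst
    rw [← hc]
    field_simp

/-! ### The norm inequality -/

theorem pauliNorm_one {n : ℕ} (H : QubitOp n) : pauliNorm 1 H = ∑ P, ‖pauliCoeff H P‖ := by
  simp [pauliNorm]

theorem IsLocalHamiltonian.normConst_mul_pauliNorm_le {n k d : ℕ} (hk : 1 ≤ k) (hd : 1 ≤ d)
    {H : QubitOp n} (hH : IsLocalHamiltonian k d H) :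
    1 / 3 * normConst k d * pauliNorm 1 H ≤ ‖H‖ := by
  obtain ⟨k, rfl⟩ := Nat.exists_eq_add_of_le' hk
  have h1 := hH.sum_norm_pauliCoeff_le
  have h2 := norm_pauliCoeff_zero_le H
  have h3 := mul_le_mul_of_nonneg_right (normConst_mul_le k d hd) (norm_nonneg H)
  have hC := (normConst_pos (k + 1) d hk hd).le
  rw [pauliNorm_one, ← Finset.add_sum_erase _ _ (Finset.mem_univ 0)]
  have h4 := mul_le_mul_of_nonneg_left (add_le_add h2 h1) hC
  linarith

theorem mainTheorem8 :
    (∀ (n k d : ℕ), 1 ≤ k → 1 ≤ d → ∀ H : QubitOp n, IsLocalHamiltonian k d H →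
      1 / 3 * normConst k d * pauliNorm 1 H ≤ ‖H‖) ∧
    (∃ g : ℕ → ℝ,
      g =Θ[atTop] (fun k : ℕ => (k : ℝ) * Real.log (k : ℝ)) ∧
      ∀ k d : ℕ, 1 ≤ k → 1 ≤ d →
        normConst k d = 1 / (√(d : ℝ) * Real.exp (g k))) ∧
    (∀ k d : ℕ, 1 ≤ k → 1 ≤ d → ∃ K : ℝ, 0 < K ∧
      ∀ (n : ℕ) (H : QubitOp n), IsLocalHamiltonian k d H →
        pauliNorm 1 H ≤ K * ‖H‖) := by
  refine ⟨fun n k d hk hd H hH => hH.normConst_mul_pauliNorm_le hk hd, exists_normConst_eq,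
    fun k d hk hd => ?_⟩
  have hC := normConst_pos k d hk hd
  refine ⟨3 / normConst k d, by positivity, fun n H hH => ?_⟩
  rw [div_mul_eq_mul_div, le_div_iff₀ hC]
  linarith [hH.normConst_mul_pauliNorm_le hk hd]
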